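/- Let $\Sigma$ be a finite alphabet and let $\mathbb{N}_{\max,+}=(\mathbb{N}\cup\{-\infty\},\max,+,-\infty,0)$ be the max-plus semiring. A weighted automaton over $\Sigma$ and $\mathbb{N}_{\max,+}$ consists of a finite set $Q$ of states, matrices $M_a\in\mathbb{N}_{\max,+}^{Q\times Q}$ for $a\in\Sigma$, and vectors $I,F\in\mathbb{N}_{\max,+}^{Q}$; its output on a word $w=a_1\cdots a_\ell$ is $I^t M_{a_1}\cdots M_{a_\ell}F$, computed in $\mathbb{N}_{\max,+}$. An accepting run over $w$ is a sequence of states $q_0,\dots,q_\ell$ with $I(q_0)\neq-\infty$, $M_{a_i}(q_{i-1},q_i)\neq-\infty$ for $1\le i\le\ell$, and $F(q_\ell)\neq-\infty$. The automaton is polynomially ambiguous if the number of accepting runs over $w$ is bounded by a polynomial in $|w|$. For $n>0$, an $n$-pumping representation of a word $w\in\Sigma^*$ is a factorisation $w=u_0\,\underline{v_1}\,u_1\,\underline{v_2}\cdots\underline{v_n}\,u_n$ with all $v_k$ nonempty. A refinement of it is an $n$-pumping representation $w=u_0'\,\underline{y_1}\,u_1'\,\underline{y_2}\cdots\underline{y_n}\,u_n'$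 such that there are words $x_k,z_k$ with $v_k=x_ky_kz_k$ for $1\le k\le n$ and $u_k'=z_ku_kx_{k+1}$ for $0\le k\le n$, where $z_0=x_{n+1}=\varepsilon$. For $S\subseteq\{1,\dots,n\}$ and $i\in\mathbb{N}$, let $w(S,i)$ be the word obtained from the refinement by replacing $y_k$ by $y_k^i$ for every $k\in S$. Given $f:\Sigma^*\to\mathbb{N}$, the refinement is linear if for every $S\subseteq\{1,\dots,n\}$ there is $K\in\mathbb{N}$ with $f(w(S,i+1))=K+f(w(S,i))$ for all sufficiently large $i$; this unique $K$ is denoted $\Delta(S)$. For a linear refinement, $S$ is decomposable if $\Delta(S)=\sum_{j\in S}\Delta(\{j\})$. A partition of $\{1,\dots,n\}$ is a sequence $S_1,\dots,S_m$ of nonempty, pairwise disjoint subsets with union $\{1,\dots,n\}$; a selection set for it is a set $S\subseteq\{1,\dots,n\}$ with $|S\cap S_j|=1$ for every $j$. Theorem (pumping lemma for polynomially ambiguous max-plus automata). Let $f:\Sigma^*\to\mathbb{N}$ be the output function of a polynomially ambiguous weighted automaton over $\mathbb{N}_{\max,+}$. There exist $N\in\mathbb{N}$ and a function $\varphi:\mathbb{N}\to\mathbb{N}$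 such that for every $n>0$, every word $w\in\Sigma^*$ and every $n$-pumping representation $w=u_0\,\underline{v_1}\,u_1\,\underline{v_2}\cdots\underline{v_n}\,u_n$ with $|v_k|\ge N$ for all $k$, there is a linear refinement $w=u_0'\,\underline{y_1}\,u_1'\,\underline{y_2}\cdots\underline{y_n}\,u_n'$ such that for every partition $S_1,\dots,S_m$ of $\{1,\dots,n\}$ with $m\ge\varphi(\max_j|S_j|)$, at least one of the following holds: 1. there is $j$ such that $S_j$ is decomposable; 2. there is a selection set $S$ for $S_1,\dots,S_m$ such that $S$ is not decomposable. -/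

import Mathlib

open Filter

/-- A weighted automaton with state set `Q` over the alphabet `α` and the semiring `R`:
transition matrices, initial vector and final vector. -/
structure WeightedAutomaton (Q α R : Type*) where
  M : α → Matrix Q Q R
  I : Q → R
  F : Q → R

namespace WeightedAutomaton

variable {Q α R : Type*} [CommSemiring R] (A : WeightedAutomaton Q α R)

/-- The matrix `M_w = M_{a₁} ⋯ M_{aₙ}` of a word `w = a₁ ⋯ aₙ`. -/
def wordMatrix [Fintype Q] [DecidableEq Q] (w : List α) : Matrix Q Q R :=
  (w.map A.M).prod

/-- The output `Iᵗ · M_w · F` of the automaton over the word `w`. -/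
def output [Fintype Q] [DecidableEq Q] (w : List α) : R :=
  A.I ⬝ᵥ (A.wordMatrix w).mulVec A.F

/-- The set of accepting runs over `w`. A run is given by its states `q₀, …, qₙ`, which determine
its transitions; it starts in an initial state, uses only transitions of weight different from
the zero of the semiring, and ends in an accepting state. -/
def acceptingRuns (w : List α) : Set (Fin (w.length + 1) → Q) :=
  {q | A.I (q 0) ≠ 0 ∧ (∀ i : Fin w.length, A.M (w.get i) (q i.castSucc) (q i.succ) ≠ 0) ∧
    A.F (q (Fin.last w.length)) ≠ 0}

/-- The number of accepting runs is bounded by a polynomial in the length of the word. -/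
def IsPolynomiallyAmbiguous : Prop :=
  ∃ p : Polynomial ℕ, ∀ w : List α, (A.acceptingRuns w).ncard ≤ p.eval w.length

end WeightedAutomaton

/-- The max-plus semiring `(ℕ ∪ {-∞}, max, +, -∞, 0)`. The order of `ℕ` is reversed, so the
adjoined top element is `-∞` and the minimum, which is the addition of `Tropical`, is the maximum
of natural numbers. -/
abbrev MaxPlus : Type := Tropical (WithTop ℕᵒᵈ)

/-- The inclusion of `ℕ` into the max-plus semiring. -/
def MaxPlus.ofNat (k : ℕ) : MaxPlus :=
  Tropical.trop ((OrderDual.toDual k : ℕᵒᵈ) : WithTop ℕᵒᵈ)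

/-- `f : Σ* → ℕ` is definable by a polynomially ambiguous weighted automaton, with a finite set
of states, over the max-plus semiring. -/
def IsPolyAmbiguouslyRecognisableMaxPlus {α : Type*} (f : List α → ℕ) : Prop :=
  ∃ (Q : Type) (_ : Fintype Q) (_ : DecidableEq Q) (A : WeightedAutomaton Q α MaxPlus),
    A.IsPolynomiallyAmbiguous ∧ ∀ w : List α, A.output w = MaxPlus.ofNat (f w)

/-- A factorisation `u₀ · v₁ · u₁ · v₂ ⋯ vₙ · uₙ` with all `vₖ` nonempty. The factor `vₖ` has
index `k - 1` in `Fin n`. -/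
structure PumpingRep (α : Type*) (n : ℕ) where
  u : Fin (n + 1) → List α
  v : Fin n → List α
  v_ne_nil : ∀ k, v k ≠ []

namespace PumpingRep

variable {α : Type*} {n : ℕ}

/-- The word `u₀ · v₁ · u₁ ⋯ vₙ · uₙ` that is represented. -/
def word (P : PumpingRep α n) : List α :=
  P.u 0 ++ (List.ofFn fun k : Fin n => P.v k ++ P.u k.succ).flatten

/-- The word `w(S, i)`: every factor `vₖ` with `k ∈ S` is repeated `i` times. -/
def pump (P : PumpingRep α n) (S : Finset (Fin n)) (i : ℕ) : List α :=
  P.u 0 ++ (List.ofFn fun k : Fin n =>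
    (if k ∈ S then (List.replicate i (P.v k)).flatten else P.v k) ++ P.u k.succ).flatten

/-- `P'` is a refinement of `P`: there are `xₖ, zₖ` with `vₖ = xₖ · yₖ · zₖ`, where `yₖ` are the
pumping factors of `P'`, and `u'ₖ = zₖ · uₖ · xₖ₊₁`, where `z₀` and `xₙ₊₁` are empty. -/
def IsRefinement (P P' : PumpingRep α n) : Prop :=
  ∃ x z : Fin n → List α,
    (∀ k, P.v k = x k ++ P'.v k ++ z k) ∧
    ∀ k : Fin (n + 1), P'.u k =
      (Fin.cons [] z : Fin (n + 1) → List α) k ++ P.u k ++ (Fin.snoc x [] : Fin (n + 1) → List α) k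

/-- For every set `S` of indices there is `K` with `f(w(S, i + 1)) = K + f(w(S, i))` for all
sufficiently large `i`. -/
def IsLinear (f : List α → ℕ) (P : PumpingRep α n) : Prop :=
  ∀ S : Finset (Fin n), ∃ K : ℕ, ∀ᶠ i in atTop, f (P.pump S (i + 1)) = K + f (P.pump S i)

/-- The value `Δ(S)`, that is, the unique `K` with `f(w(S, i + 1)) = K + f(w(S, i))` for all
sufficiently large `i`. -/
noncomputable def delta {f : List α → ℕ} {P : PumpingRep α n} (h : P.IsLinear f)
    (S : Finset (Fin n)) : ℕ :=
  (h S).choose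

theorem eventually_delta {f : List α → ℕ} {P : PumpingRep α n} (h : P.IsLinear f)
    (S : Finset (Fin n)) :
    ∀ᶠ i in atTop, f (P.pump S (i + 1)) = delta h S + f (P.pump S i) :=
  (h S).choose_spec

theorem delta_eq {f : List α → ℕ} {P : PumpingRep α n} (h : P.IsLinear f)
    (S : Finset (Fin n)) {K : ℕ}
    (hK : ∀ᶠ i in atTop, f (P.pump S (i + 1)) = K + f (P.pump S i)) : delta h S = K := by
  obtain ⟨i, h₁, h₂⟩ := ((eventually_delta h S).and hK).exists
  omega

/-- `Δ(S)` is the sum of the values `Δ({j})` over `j ∈ S`. -/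
def IsDecomposable {f : List α → ℕ} {P : PumpingRep α n} (h : P.IsLinear f)
    (S : Finset (Fin n)) : Prop :=
  delta h S = ∑ j ∈ S, delta h {j}

end PumpingRep

/-- `S₁, …, Sₘ` are nonempty, pairwise disjoint, and their union is the whole index set. -/
def IsPartitionSeq {n m : ℕ} (S : Fin m → Finset (Fin n)) : Prop :=
  (∀ j, (S j).Nonempty) ∧ (∀ i j, i ≠ j → Disjoint (S i) (S j)) ∧ ∀ k, ∃ j, k ∈ S j

/-- `T` meets every `Sⱼ` in exactly one element. -/
def IsSelectionSet {n m : ℕ} (S : Fin m → Finset (Fin n)) (T : Finset (Fin n)) : Prop :=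
  ∀ j, (T ∩ S j).card = 1

/-! The refinement replaces each `vₖ` by a factor `yₖ` whose reachability relation on states is
idempotent; Ramsey's theorem finds one in every long word (`exists_idempotent_factor`). Polynomial
ambiguity forbids cycles over `yₖ` between two different useful states, since these would give
exponentially many runs over powers of `yₖ` (`IsIdempotentWord.antisymm`). So a run over `yₖ^i`
leaves its current state at most `|Q|` times and otherwise takes loops over `yₖ`; up to a constant
its weight is at most `i` times that of the best loop it meets (`exists_loop`).

An anchor chooses a loop state for every `k`, all compatible with one accepting run. Then `Δ(S)` is
the maximum over anchors of the sum over `S` of loop weights (`eventually_pump`). The set of anchors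
does not depend on `S`, so `S` is decomposable iff one anchor is optimal at all indices of `S` at
once (`isDecomposable_iff`).

If both alternatives fail, the optimal set of each anchor misses a point of every `Sⱼ`, yet every
selection lies in some optimal set. With `s = max |Sⱼ|` this forces at least `((s + 1) / s)^m`
anchors (`succ_pow_le_pow_mul_card`). But anchors inject into the accepting runs of a word of length
`O(n)`, and `n ≤ m * s`, so their number is polynomial in `m` for fixed `s`
(`exists_card_anchor_le`). This is impossible for large `m`. -/

namespace MaxPlus

/-! ### Arithmetic of the max-plus semiring. -/

theorem ofNat_ne_zero (k : ℕ) : ofNat k ≠ 0 := by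
  intro h
  have := congrArg Tropical.untrop h
  simp [ofNat] at this

theorem exists_eq_ofNat {x : MaxPlus} (h : x ≠ 0) : ∃ k, x = ofNat k := by
  rcases hx : Tropical.untrop x with _ | k
  · exact absurd (Tropical.untrop_injective hx) h
  · exact ⟨OrderDual.ofDual k, Tropical.untrop_injective hx⟩

theorem ofNat_injective : Function.Injective ofNat := by
  intro a b h
  have := congrArg Tropical.untrop h
  simpa [ofNat] using this

theorem ofNat_mul (a b : ℕ) : ofNat a * ofNat b = ofNat (a + b) := rfl

theorem ofNat_zero : ofNat 0 = 1 := rfl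

theorem ofNat_add (a b : ℕ) : ofNat a + ofNat b = ofNat (max a b) := by
  apply Tropical.untrop_injective
  rw [Tropical.untrop_add]
  simp only [ofNat, Tropical.untrop_trop, ← WithTop.coe_min, ← toDual_max]

theorem mul_eq_ofNat {x y : MaxPlus} {c : ℕ} (h : x * y = ofNat c) :
    ∃ a b, x = ofNat a ∧ y = ofNat b ∧ c = a + b := by
  have hx : x ≠ 0 := by rintro rfl; exact ofNat_ne_zero c (by rw [← h, zero_mul])
  have hy : y ≠ 0 := by rintro rfl; exact ofNat_ne_zero c (by rw [← h, mul_zero])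
  obtain ⟨a, rfl⟩ := exists_eq_ofNat hx
  obtain ⟨b, rfl⟩ := exists_eq_ofNat hy
  exact ⟨a, b, rfl, rfl, ofNat_injective (by rw [← h, ofNat_mul])⟩

theorem add_eq_ofNat {x y : MaxPlus} {c : ℕ} (h : x + y = ofNat c) :
    x = ofNat c ∨ y = ofNat c := by
  rcases eq_or_ne x 0 with rfl | hx
  · exact .inr (by rwa [zero_add] at h)
  rcases eq_or_ne y 0 with rfl | hy
  · exact .inl (by rwa [add_zero] at h)
  obtain ⟨a, rfl⟩ := exists_eq_ofNat hx
  obtain ⟨b, rfl⟩ := exists_eq_ofNat hy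
  rw [ofNat_add] at h
  rcases max_choice a b with hm | hm <;> rw [hm] at h <;> simp [h]

theorem exists_ofNat_add_eq (a : ℕ) (y : MaxPlus) : ∃ c, a ≤ c ∧ ofNat a + y = ofNat c := by
  rcases eq_or_ne y 0 with rfl | hy
  · exact ⟨a, le_rfl, add_zero _⟩
  obtain ⟨b, rfl⟩ := exists_eq_ofNat hy
  exact ⟨max a b, le_max_left _ _, ofNat_add a b⟩

theorem sum_eq_ofNat {ι : Type*} {s : Finset ι} {g : ι → MaxPlus} {c : ℕ}
    (h : ∑ r ∈ s, g r = ofNat c) : ∃ r ∈ s, g r = ofNat c := by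
  classical
  induction s using Finset.induction_on with
  | empty => exact absurd h.symm (ofNat_ne_zero c)
  | insert a s ha ih =>
    rw [Finset.sum_insert ha] at h
    rcases add_eq_ofNat h with h | h
    · exact ⟨a, Finset.mem_insert_self _ _, h⟩
    · obtain ⟨r, hr, h⟩ := ih h
      exact ⟨r, Finset.mem_insert_of_mem hr, h⟩

theorem exists_sum_eq_ofNat {ι : Type*} {s : Finset ι} {g : ι → MaxPlus} {r : ι} (hr : r ∈ s)
    {c : ℕ} (h : g r = ofNat c) : ∃ c', c ≤ c' ∧ ∑ r ∈ s, g r = ofNat c' := by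
  classical
  rw [← Finset.add_sum_erase s g hr, h]
  exact exists_ofNat_add_eq c _

end MaxPlus

/-! ### Runs and their weights. -/

namespace WeightedAutomaton

variable {Q α : Type*} (A : WeightedAutomaton Q α MaxPlus)

/-- There is a run of weight `c` over `w` from `p` to `q`. -/
def HasRun : Q → List α → Q → ℕ → Prop
  | p, [], q, c => p = q ∧ c = 0
  | p, a :: w, q, c => ∃ r c₁ c₂, A.M a p r = MaxPlus.ofNat c₁ ∧ HasRun r w q c₂ ∧ c = c₁ + c₂

/-- There is a run over `w` from `p` to `q`. -/
def Reach (p : Q) (w : List α) (q : Q) : Prop := ∃ c, A.HasRun p w q c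

variable {A}

theorem HasRun.reach {p q : Q} {w : List α} {c : ℕ} (h : A.HasRun p w q c) : A.Reach p w q :=
  ⟨c, h⟩

theorem hasRun_append {p q : Q} {u v : List α} {c : ℕ} :
    A.HasRun p (u ++ v) q c ↔
      ∃ r c₁ c₂, A.HasRun p u r c₁ ∧ A.HasRun r v q c₂ ∧ c = c₁ + c₂ := by
  induction u generalizing p c with
  | nil =>
    constructor
    · intro h
      exact ⟨p, 0, c, ⟨rfl, rfl⟩, h, by simp⟩
    · rintro ⟨r, c₁, c₂, ⟨rfl, rfl⟩, h, rfl⟩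
      simpa using h
  | cons a u ih =>
    constructor
    · rintro ⟨r, c₁, c₂, h, h', rfl⟩
      obtain ⟨r', d₁, d₂, h₁, h₂, rfl⟩ := ih.1 h'
      exact ⟨r', c₁ + d₁, d₂, ⟨r, c₁, d₁, h, h₁, rfl⟩, h₂, by omega⟩
    · rintro ⟨r', d₁, d₂, ⟨r, c₁, c₂, h, h₁, rfl⟩, h₂, rfl⟩
      exact ⟨r, c₁, c₂ + d₂, h, ih.2 ⟨r', c₂, d₂, h₁, h₂, rfl⟩, by omega⟩

theorem HasRun.append {p q r : Q} {u v : List α} {c d : ℕ} (h : A.HasRun p u q c)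
    (h' : A.HasRun q v r d) : A.HasRun p (u ++ v) r (c + d) :=
  hasRun_append.2 ⟨q, c, d, h, h', rfl⟩

theorem Reach.append {p q r : Q} {u v : List α} (h : A.Reach p u q)
    (h' : A.Reach q v r) : A.Reach p (u ++ v) r :=
  (h.choose_spec.append h'.choose_spec).reach

theorem reach_append {p q : Q} {u v : List α} :
    A.Reach p (u ++ v) q ↔ ∃ r, A.Reach p u r ∧ A.Reach r v q := by
  constructor
  · rintro ⟨c, h⟩
    obtain ⟨r, c₁, c₂, h₁, h₂, -⟩ := hasRun_append.1 h
    exact ⟨r, h₁.reach, h₂.reach⟩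
  · rintro ⟨r, h₁, h₂⟩
    exact h₁.append h₂

theorem hasRun_flatten {p q : Q} {ws : List (List α)} {c : ℕ} :
    A.HasRun p ws.flatten q c ↔ ∃ (r : ℕ → Q) (d : ℕ → ℕ), r 0 = p ∧ r ws.length = q ∧
      (∀ j (h : j < ws.length), A.HasRun (r j) ws[j] (r (j + 1)) (d j)) ∧
      c = ∑ j ∈ Finset.range ws.length, d j := by
  induction ws generalizing p c with
  | nil =>
    constructor
    · rintro ⟨rfl, rfl⟩
      exact ⟨fun _ => p, fun _ => 0, rfl, rfl, by simp, by simp⟩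
    · rintro ⟨r, d, rfl, rfl, -, rfl⟩
      exact ⟨rfl, by simp⟩
  | cons w ws ih =>
    rw [List.flatten_cons, hasRun_append]
    constructor
    · rintro ⟨p', c₁, c₂, h, h', rfl⟩
      obtain ⟨r, d, rfl, rfl, hr, rfl⟩ := ih.1 h'
      refine ⟨fun j => Nat.casesOn j p r, fun j => Nat.casesOn j c₁ d, rfl, rfl, ?_, ?_⟩
      · rintro (_ | j) hj
        · exact h
        · exact hr j (by simpa using hj)
      · rw [List.length_cons, Finset.sum_range_succ']
        exact add_comm _ _
    · rintro ⟨r, d, rfl, rfl, hr, rfl⟩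
      refine ⟨r 1, d 0, ∑ j ∈ Finset.range ws.length, d (j + 1), hr 0 (by simp), ?_, ?_⟩
      · exact ih.2 ⟨fun j => r (j + 1), fun j => d (j + 1), rfl, rfl,
          fun j hj => hr (j + 1) (by simpa using hj), rfl⟩
      · rw [List.length_cons, Finset.sum_range_succ']
        exact add_comm _ _

/-- A word `w` has an accepting run of total weight `c`, initial and final weights included. -/
def HasAcceptingWeight (A : WeightedAutomaton Q α MaxPlus) (w : List α) (c : ℕ) : Prop :=
  ∃ p q c₀ c₁ c₂, A.I p = MaxPlus.ofNat c₀ ∧ A.HasRun p w q c₁ ∧ A.F q = MaxPlus.ofNat c₂ ∧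
    c = c₀ + c₁ + c₂

section Output

variable [Fintype Q] [DecidableEq Q]

theorem hasRun_of_wordMatrix_eq {p q : Q} {w : List α} {c : ℕ}
    (h : A.wordMatrix w p q = MaxPlus.ofNat c) : A.HasRun p w q c := by
  induction w generalizing p c with
  | nil =>
    by_cases hpq : p = q
    · subst hpq
      refine ⟨rfl, MaxPlus.ofNat_injective ?_⟩
      rw [← h, MaxPlus.ofNat_zero]
      simp [wordMatrix]
    · refine absurd h.symm ?_
      simpa [wordMatrix, hpq] using MaxPlus.ofNat_ne_zero c
  | cons a w ih =>
    have h' : ∑ r, A.M a p r * A.wordMatrix w r q = MaxPlus.ofNat c := by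
      rw [← h]
      simp [wordMatrix, Matrix.mul_apply]
    obtain ⟨r, -, hr⟩ := MaxPlus.sum_eq_ofNat h'
    obtain ⟨c₁, c₂, h₁, h₂, rfl⟩ := MaxPlus.mul_eq_ofNat hr
    exact ⟨r, c₁, c₂, h₁, ih h₂, rfl⟩

theorem HasRun.exists_wordMatrix_eq {p q : Q} {w : List α} {c : ℕ} (h : A.HasRun p w q c) :
    ∃ c', c ≤ c' ∧ A.wordMatrix w p q = MaxPlus.ofNat c' := by
  induction w generalizing p c with
  | nil =>
    obtain ⟨rfl, rfl⟩ := h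
    exact ⟨0, le_rfl, by simp [wordMatrix, MaxPlus.ofNat_zero]⟩
  | cons a w ih =>
    obtain ⟨r, c₁, c₂, h₁, h₂, rfl⟩ := h
    obtain ⟨c₃, hc, h₃⟩ := ih h₂
    have hr : A.M a p r * A.wordMatrix w r q = MaxPlus.ofNat (c₁ + c₃) := by
      rw [h₁, h₃, MaxPlus.ofNat_mul]
    obtain ⟨c', hc', h'⟩ := MaxPlus.exists_sum_eq_ofNat (Finset.mem_univ r) hr
      (g := fun r => A.M a p r * A.wordMatrix w r q)
    refine ⟨c', by omega, ?_⟩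
    rw [← h']
    simp [wordMatrix, Matrix.mul_apply]

/-- Sums are maxima, so some summand attains the output and none exceeds it. This replaces matrices
by weights of runs. -/
theorem isGreatest_of_output_eq {w : List α} {c : ℕ} (h : A.output w = MaxPlus.ofNat c) :
    IsGreatest {d | A.HasAcceptingWeight w d} c := by
  have h' : ∑ p, A.I p * ∑ q, A.wordMatrix w p q * A.F q = MaxPlus.ofNat c := by
    rw [← h]
    simp [output, dotProduct, Matrix.mulVec]
  constructor
  · obtain ⟨p, -, hp⟩ := MaxPlus.sum_eq_ofNat h'
    obtain ⟨c₀, c', h₀, hp', rfl⟩ := MaxPlus.mul_eq_ofNat hp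
    obtain ⟨q, -, hq⟩ := MaxPlus.sum_eq_ofNat hp'
    obtain ⟨c₁, c₂, h₁, h₂, rfl⟩ := MaxPlus.mul_eq_ofNat hq
    exact ⟨p, q, c₀, c₁, c₂, h₀, hasRun_of_wordMatrix_eq h₁, h₂, by omega⟩
  · rintro d ⟨p, q, c₀, c₁, c₂, h₀, h₁, h₂, rfl⟩
    obtain ⟨c₁', hc₁, h₁⟩ := h₁.exists_wordMatrix_eq
    obtain ⟨e, he, hq⟩ := MaxPlus.exists_sum_eq_ofNat (Finset.mem_univ q)
      (g := fun q => A.wordMatrix w p q * A.F q) (c := c₁' + c₂)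
      (by rw [h₁, h₂, MaxPlus.ofNat_mul])
    obtain ⟨e', he', hp⟩ := MaxPlus.exists_sum_eq_ofNat (Finset.mem_univ p)
      (g := fun p => A.I p * ∑ q, A.wordMatrix w p q * A.F q) (c := c₀ + e)
      (by rw [h₀, hq, MaxPlus.ofNat_mul])
    have := MaxPlus.ofNat_injective (hp.symm.trans h')
    omega

end Output

/-- A matrix entry bounds all runs between its two states, and there are finitely many entries. -/
theorem exists_hasRun_le [Finite Q] (A : WeightedAutomaton Q α MaxPlus) (w : List α) :
    ∃ W, ∀ p q c, A.HasRun p w q c → c ≤ W := by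
  classical
  cases nonempty_fintype Q
  have key : ∀ x : Q × Q, ∃ W, ∀ c, A.HasRun x.1 w x.2 c → c ≤ W := by
    rintro ⟨p, q⟩
    by_cases h : A.Reach p w q
    · obtain ⟨c₀, h₀⟩ := h
      obtain ⟨W, -, hW⟩ := h₀.exists_wordMatrix_eq
      refine ⟨W, fun c hc => ?_⟩
      obtain ⟨c', hc', h'⟩ := hc.exists_wordMatrix_eq
      have := MaxPlus.ofNat_injective (hW.symm.trans h')
      omega
    · exact ⟨0, fun c hc => absurd hc.reach h⟩
  choose W hW using key
  exact ⟨Finset.univ.sup W, fun p q c h =>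
    (hW (p, q) c h).trans (Finset.le_sup (Finset.mem_univ (p, q)))⟩

/-- The largest weight of a run over `w` from `p` to `p`. -/
noncomputable def loopWeight (A : WeightedAutomaton Q α MaxPlus) (w : List α) (p : Q) : ℕ :=
  sSup {c | A.HasRun p w p c}

theorem HasRun.le_loopWeight [Finite Q] {p : Q} {w : List α} {c : ℕ} (h : A.HasRun p w p c) :
    c ≤ A.loopWeight w p := by
  obtain ⟨W, hW⟩ := A.exists_hasRun_le w
  exact le_csSup ⟨W, fun c hc => hW p p c hc⟩ h

/-- The supremum is attained because the set is bounded and, by hypothesis, nonempty; without a loop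
`sSup` would give the default value 0. -/
theorem Reach.hasRun_loopWeight [Finite Q] {p : Q} {w : List α} (h : A.Reach p w p) :
    A.HasRun p w p (A.loopWeight w p) := by
  obtain ⟨W, hW⟩ := A.exists_hasRun_le w
  exact Nat.sSup_mem h ⟨W, fun c hc => hW p p c hc⟩

end WeightedAutomaton

/-! ### Growth rates and Ramsey's theorem. -/

/-- An exponential with larger base outgrows a polynomial times an exponential. -/
theorem eventually_pow_mul_eval_lt_pow (q : Polynomial ℕ) {s t : ℕ} (h : s < t) :
    ∀ᶠ m : ℕ in atTop, s ^ m * q.eval m < t ^ m := by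
  have key : ∀ q : Polynomial ℕ,
      Tendsto (fun m : ℕ => ((q.eval m : ℕ) : ℝ) * ((s : ℝ) / t) ^ m) atTop (nhds 0) := by
    intro q
    have ht : (0 : ℝ) < t := by exact_mod_cast (Nat.zero_le s).trans_lt h
    have hr : |(s : ℝ) / t| < 1 := by
      rw [abs_of_nonneg (by positivity), div_lt_one ht]
      exact_mod_cast h
    induction q using Polynomial.induction_on' with
    | add p q hp hq =>
      simpa [add_mul] using hp.add hq
    | monomial k a =>
      simpa [mul_assoc] using
        (tendsto_pow_const_mul_const_pow_of_abs_lt_one k hr).const_mul (a : ℝ)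
  have ht : (0 : ℝ) < t := by exact_mod_cast (Nat.zero_le s).trans_lt h
  filter_upwards [(key q).eventually_lt_const one_pos] with m hm
  rw [div_pow, ← mul_div_assoc, div_lt_one (by positivity)] at hm
  rw [mul_comm]
  exact_mod_cast hm

/-- Multicolour Ramsey theorem for triangles. -/
theorem exists_monochromatic_triangle {κ : Type*} [DecidableEq κ] (c : ℕ) :
    ∃ R, ∀ (C : Finset κ), C.card = c → ∀ (V : Finset ℕ), R ≤ V.card →
      ∀ col : ℕ → ℕ → κ, (∀ i ∈ V, ∀ j ∈ V, i < j → col i j ∈ C) →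
      ∃ i ∈ V, ∃ j ∈ V, ∃ k ∈ V, i < j ∧ j < k ∧ col i j = col j k ∧ col i k = col j k := by
  induction c with
  | zero =>
    refine ⟨2, fun C hC V hV col hcol => ?_⟩
    obtain ⟨i, hi, j, hj, hij⟩ := Finset.one_lt_card.1 hV
    rw [Finset.card_eq_zero] at hC
    subst hC
    rcases lt_or_gt_of_ne hij with h | h
    · exact absurd (hcol i hi j hj h) (Finset.notMem_empty _)
    · exact absurd (hcol j hj i hi h) (Finset.notMem_empty _)
  | succ c ih =>
    obtain ⟨R, hR⟩ := ih
    -- The least vertex `v` has more than `(c + 1) * R` later neighbours, so one of the `c + 1`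
    -- colours occurs on more than `R` of its edges.
    refine ⟨(c + 1) * R + 2, fun C hC V hV col hcol => ?_⟩
    have hne : V.Nonempty := Finset.card_pos.1 (by omega)
    set v := V.min' hne
    have hv : v ∈ V := V.min'_mem hne
    have hlt : ∀ i ∈ V.erase v, v < i := fun i hi =>
      lt_of_le_of_ne (V.min'_le i (Finset.mem_of_mem_erase hi)) (Finset.ne_of_mem_erase hi).symm
    have hcard : (V.erase v).card = V.card - 1 := Finset.card_erase_of_mem hv
    obtain ⟨a, ha, haR⟩ := Finset.exists_lt_card_fiber_of_mul_lt_card_of_maps_to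
      (s := V.erase v) (t := C) (f := fun i => col v i) (n := R)
      (fun i hi => hcol v hv i (Finset.mem_of_mem_erase hi) (hlt i hi)) (by rw [hC]; omega)
    set V' := {i ∈ V.erase v | col v i = a}
    have hV' : ∀ i ∈ V', i ∈ V ∧ v < i ∧ col v i = a := fun i hi => by
      have := Finset.mem_filter.1 hi
      exact ⟨Finset.mem_of_mem_erase this.1, hlt i this.1, this.2⟩
    -- Either an edge of colour `a` closes a triangle with `v`, or `V'` uses only the other `c`
    -- colours.
    by_cases hex : ∃ i ∈ V', ∃ j ∈ V', i < j ∧ col i j = a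
    · obtain ⟨i, hi, j, hj, hij, hc⟩ := hex
      exact ⟨v, hv, i, (hV' i hi).1, j, (hV' j hj).1, (hV' i hi).2.1, hij,
        (hV' i hi).2.2.trans hc.symm, (hV' j hj).2.2.trans hc.symm⟩
    · push Not at hex
      obtain ⟨i, hi, j, hj, k, hk, h⟩ := hR (C.erase a)
        (by rw [Finset.card_erase_of_mem ha, hC]; rfl) V' haR.le col
        (fun i hi j hj hij => Finset.mem_erase.2
          ⟨hex i hi j hj hij, hcol i (hV' i hi).1 j (hV' j hj).1 hij⟩)
      exact ⟨i, (hV' i hi).1, j, (hV' j hj).1, k, (hV' k hk).1, h⟩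

theorem List.drop_take_append_drop_take {α : Type*} (v : List α) {i j k : ℕ} (hij : i ≤ j)
    (hjk : j ≤ k) : (v.take j).drop i ++ (v.take k).drop j = (v.take k).drop i := by
  have h : v.take j = (v.take k).take j := by rw [List.take_take, min_eq_left hjk]
  rw [h, List.drop_take]
  conv_rhs => rw [← List.take_append_drop (j - i) ((v.take k).drop i)]
  rw [List.drop_drop]
  congr 3
  omega

/-! ### Idempotent factors and counting runs by checkpoints. -/

namespace WeightedAutomaton

variable {Q α : Type*} {A : WeightedAutomaton Q α MaxPlus}

/-- The reachability relation of `y` is idempotent. -/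
def IsIdempotentWord (A : WeightedAutomaton Q α MaxPlus) (y : List α) : Prop :=
  ∀ p q, A.Reach p (y ++ y) q ↔ A.Reach p y q

/-- Colour a pair `i < j` of positions by the reachability relation of the factor between them. In a
monochromatic triangle two adjacent factors and their concatenation share one relation, which is
therefore idempotent. -/
theorem exists_idempotent_factor [Finite Q] (A : WeightedAutomaton Q α MaxPlus) :
    ∃ N, ∀ v : List α, N ≤ v.length →
      ∃ x y z, v = x ++ y ++ z ∧ y ≠ [] ∧ A.IsIdempotentWord y := by
  classical
  cases nonempty_fintype Q
  obtain ⟨R, hR⟩ := exists_monochromatic_triangle (κ := Q → Q → Prop)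
    (Finset.univ : Finset (Q → Q → Prop)).card
  refine ⟨R, fun v hv => ?_⟩
  obtain ⟨i, hi, j, hj, k, hk, hij, hjk, h₁, h₂⟩ := hR Finset.univ rfl (Finset.range v.length)
    (by simpa using hv) (fun i j p q => A.Reach p ((v.take j).drop i) q) (by simp)
  simp only [Finset.mem_range] at hi hj hk
  refine ⟨v.take i, (v.take k).drop i, v.drop k, ?_, ?_, ?_⟩
  · have : v.take i = (v.take k).take i := by rw [List.take_take, min_eq_left (by omega)]
    rw [this, List.take_append_drop, List.take_append_drop]
  · rw [← List.length_pos_iff]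
    simp
    omega
  · intro p q
    have e₁ : ∀ p q, A.Reach p ((v.take j).drop i) q ↔ A.Reach p ((v.take k).drop j) q :=
      fun p q => Iff.of_eq (congrFun (congrFun h₁ p) q)
    have e₂ : ∀ p q, A.Reach p ((v.take k).drop i) q ↔ A.Reach p ((v.take k).drop j) q :=
      fun p q => Iff.of_eq (congrFun (congrFun h₂ p) q)
    conv_rhs => rw [← List.drop_take_append_drop_take v hij.le hjk.le]
    simp only [reach_append, e₁, e₂]

/-- There are finitely many relations on `Q`; fix one word for each that occurs. This makes the
anchor count independent of the lengths of the factors. -/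
theorem exists_short_word [Finite Q] (A : WeightedAutomaton Q α MaxPlus) :
    ∃ C, ∀ w, ∃ w' : List α, w'.length ≤ C ∧ ∀ p q, A.Reach p w' q ↔ A.Reach p w q := by
  classical
  have hfin : (Set.range fun (w : List α) p q => A.Reach p w q).Finite := Set.toFinite _
  choose g hg using fun x : Set.range fun (w : List α) p q => A.Reach p w q => x.2
  have := hfin.fintype
  refine ⟨Finset.univ.sup fun x => (g x).length, fun w => ⟨g ⟨_, w, rfl⟩, ?_, fun p q => ?_⟩⟩
  · exact Finset.le_sup (f := fun x => (g x).length) (Finset.mem_univ _)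
  · exact Iff.of_eq (congrFun (congrFun (hg ⟨_, w, rfl⟩) p) q)

/-- The states `r 0, …, r w.length` form a run over `w`. -/
def IsRun (A : WeightedAutomaton Q α MaxPlus) (w : List α) (r : ℕ → Q) : Prop :=
  ∀ i (h : i < w.length), A.M w[i] (r i) (r (i + 1)) ≠ 0

theorem IsRun.append {u v : List α} {r s : ℕ → Q} (hr : A.IsRun u r) (hs : A.IsRun v s)
    (h : r u.length = s 0) :
    A.IsRun (u ++ v) fun i => if i ≤ u.length then r i else s (i - u.length) := by
  intro i hi
  rcases lt_or_ge i u.length with h' | h'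
  · simpa [List.getElem_append_left h', h'.le, Nat.succ_le_of_lt h'] using hr i h'
  · have hs := hs (i - u.length) (by simp at hi; omega)
    simp only [List.getElem_append_right h', show ¬ i + 1 ≤ u.length by omega, if_false]
    rw [Nat.sub_add_comm h']
    rcases h'.eq_or_lt with h'' | h''
    · subst h''
      simpa [h] using hs
    · simpa [show ¬ i ≤ u.length by omega] using hs

theorem HasRun.exists_isRun {p q : Q} {w : List α} {c : ℕ} (h : A.HasRun p w q c) :
    ∃ r, A.IsRun w r ∧ r 0 = p ∧ r w.length = q := by
  induction w generalizing p c with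
  | nil =>
    obtain ⟨rfl, -⟩ := h
    exact ⟨fun _ => p, by simp [IsRun], rfl, rfl⟩
  | cons a w ih =>
    obtain ⟨p', c₁, c₂, h₁, h₂, -⟩ := h
    obtain ⟨r, hr, rfl, rfl⟩ := ih h₂
    refine ⟨fun j => Nat.casesOn j p r, ?_, rfl, rfl⟩
    rintro (_ | i) hi
    · simpa [h₁] using MaxPlus.ofNat_ne_zero c₁
    · exact hr i (by simpa using hi)

theorem exists_isRun_flatten (ws : List (List α)) (s : ℕ → Q)
    (h : ∀ j (hj : j < ws.length), A.Reach (s j) ws[j] (s (j + 1))) :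
    ∃ r, A.IsRun ws.flatten r ∧ ∀ j ≤ ws.length, r (ws.take j).flatten.length = s j := by
  induction ws generalizing s with
  | nil => exact ⟨fun _ => s 0, by simp [IsRun], by simp⟩
  | cons w ws ih =>
    obtain ⟨r₂, hr₂, hs₂⟩ := ih (fun j => s (j + 1)) fun j hj => h (j + 1) (by simpa using hj)
    obtain ⟨c, hc⟩ := h 0 (by simp)
    obtain ⟨r₁, hr₁, h₀, h₁⟩ := hc.exists_isRun
    simp only [List.getElem_cons_zero] at h₁ hr₁
    have h₀' : r₂ 0 = s 1 := by simpa using hs₂ 0 (by simp)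
    refine ⟨_, hr₁.append hr₂ (h₁.trans h₀'.symm), ?_⟩
    rintro (_ | j) hj
    · simpa using h₀
    · have := hs₂ j (by simpa using hj)
      simp only [List.take_succ_cons, List.flatten_cons, List.length_append]
      -- In the first case the preceding factors of `ws` are empty, so the position is the junction,
      -- where both runs agree.
      split_ifs with hle
      · have hz : (ws.take j).flatten.length = 0 := by omega
        rw [hz] at this ⊢
        rw [add_zero, h₁, ← this, h₀']
      · simpa using this

/-- Sequences of checkpoints between the factors of a word are no more numerous than the accepting
runs over the word. -/
theorem card_le_ncard_acceptingRuns [Finite Q] (ws : List (List α)) {ι : Type*} (X : Finset ι)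
    (s : ι → ℕ → Q) (hI : ∀ x ∈ X, A.I (s x 0) ≠ 0) (hF : ∀ x ∈ X, A.F (s x ws.length) ≠ 0)
    (h : ∀ x ∈ X, ∀ j (hj : j < ws.length), A.Reach (s x j) ws[j] (s x (j + 1)))
    (hinj : ∀ x ∈ X, ∀ x' ∈ X, (∀ j ≤ ws.length, s x j = s x' j) → x = x') :
    X.card ≤ (A.acceptingRuns ws.flatten).ncard := by
  have hr : ∀ x : X, ∃ r, A.IsRun ws.flatten r ∧
      ∀ j ≤ ws.length, r (ws.take j).flatten.length = s x j :=
    fun x => exists_isRun_flatten ws (s x) (h x x.2)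
  choose r hr hs using hr
  have hle : ∀ j, (ws.take j).flatten.length < ws.flatten.length + 1 := fun j => by
    conv_rhs => rw [← List.take_append_drop j ws, List.flatten_append, List.length_append]
    omega
  rw [← Fintype.card_coe, ← Finset.card_univ, ← Set.ncard_coe_finset]
  refine Set.ncard_le_ncard_of_injOn (fun (x : X) i => r x i.val) ?_ ?_ (Set.toFinite _)
  · intro x _
    refine ⟨?_, fun i => ?_, ?_⟩
    · have := hs x 0 (by simp)
      simp only [List.take_zero, List.flatten_nil, List.length_nil] at this
      simpa [this] using hI x x.2
    · simpa using hr x i i.2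
    · have := hs x ws.length le_rfl
      rw [List.take_length] at this
      change A.F (r x ws.flatten.length) ≠ 0
      rw [this]
      exact hF x x.2
  · intro x _ x' _ hxx'
    refine Subtype.ext (hinj x x.2 x' x'.2 fun j hj => ?_)
    rw [← hs x j hj, ← hs x' j hj]
    exact congrFun hxx' ⟨_, hle j⟩

end WeightedAutomaton

/-! ### Loops over idempotent words. -/

namespace WeightedAutomaton

variable {Q α : Type*} {A : WeightedAutomaton Q α MaxPlus}

/-- Some initial state reaches `p`. -/
def IsAccessible (A : WeightedAutomaton Q α MaxPlus) (p : Q) : Prop :=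
  ∃ a x, A.I a ≠ 0 ∧ A.Reach a x p

/-- `p` reaches some final state. -/
def IsCoaccessible (A : WeightedAutomaton Q α MaxPlus) (p : Q) : Prop :=
  ∃ b z, A.F b ≠ 0 ∧ A.Reach p z b

theorem IsAccessible.of_reach {p q : Q} {w : List α} (hp : A.IsAccessible p)
    (h : A.Reach p w q) : A.IsAccessible q := by
  obtain ⟨a, x, ha, hx⟩ := hp
  exact ⟨a, x ++ w, ha, hx.append h⟩

theorem IsCoaccessible.of_reach {p q : Q} {w : List α} (hq : A.IsCoaccessible q)
    (h : A.Reach p w q) : A.IsCoaccessible p := by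
  obtain ⟨b, z, hb, hz⟩ := hq
  exact ⟨b, w ++ z, hb, h.append hz⟩

/-- In a polynomially ambiguous automaton, an idempotent word has no cycle through two different
useful states. -/
theorem IsIdempotentWord.antisymm [Finite Q] (hA : A.IsPolynomiallyAmbiguous) {y : List α}
    (hy : A.IsIdempotentWord y) {p q : Q} (hp : A.IsAccessible p) (hp' : A.IsCoaccessible p)
    (hpq : A.Reach p y q) (hqp : A.Reach q y p) : p = q := by
  classical
  by_contra hne
  obtain ⟨a, x, ha, hx⟩ := hp
  obtain ⟨b, z, hb, hz⟩ := hp'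
  obtain ⟨P, hP⟩ := hA
  have hpp : A.Reach p y p := (hy p p).1 (hpq.append hqp)
  have hqq : A.Reach q y q := (hy q q).1 (hqp.append hpq)
  -- Over `x y · y^i · y z` each of the `i + 1` inner checkpoints may be `p` or `q` freely, because
  -- `y` connects all four pairs.
  have key : ∀ i : ℕ, 2 ^ (i + 1) ≤ P.eval (x.length + y.length + i * y.length +
      (y.length + z.length)) := by
    intro i
    set ws : List (List α) := (x ++ y) :: (List.replicate i y ++ [y ++ z])
    have hlen : ws.length = i + 2 := by simp [ws]
    let s : (Fin (i + 1) → Bool) → ℕ → Q := fun β j =>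
      if j = 0 then a else if h : j - 1 < i + 1 then (if β ⟨j - 1, h⟩ then q else p) else b
    have hs : ∀ β (j : ℕ) (h : j < i + 1), s β (j + 1) = if β ⟨j, h⟩ then q else p := by
      intro β j h
      simp [s, Nat.le_of_lt_succ h]
    have hlast : ∀ β, s β (i + 2) = b := by
      intro β
      simp [s]
    have hcard := card_le_ncard_acceptingRuns (A := A) ws
      (Finset.univ : Finset (Fin (i + 1) → Bool)) s (fun _ _ => ha)
      (fun β _ => by rw [hlen, hlast]; exact hb) ?_ ?_
    · have hflat : ws.flatten.length =
          x.length + y.length + i * y.length + (y.length + z.length) := by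
        simp [ws]
        ring
      simpa [← hflat] using hcard.trans (hP _)
    · rintro β - j hj
      rw [hlen] at hj
      rcases j with _ | j
      · rw [hs β 0 (by omega)]
        change A.Reach a (x ++ y) _
        split_ifs
        · exact hx.append hpq
        · exact hx.append hpp
      · rw [hs β j (by omega)]
        rcases lt_or_ge j i with h | h
        · rw [hs β (j + 1) (by omega)]
          have : ws[j + 1] = y := by
            simp [ws, h]
          rw [this]
          split_ifs <;> assumption
        · obtain rfl : j = i := by omega
          have : ws[j + 1] = y ++ z := by
            simp [ws]
          rw [this, hlast]
          split_ifs
          · exact hqp.append hz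
          · exact hpp.append hz
    · rintro β - β' - h
      funext j
      have := h (j + 1) (by rw [hlen]; omega)
      rw [hs _ j j.2, hs _ j j.2] at this
      by_cases h₁ : β j <;> by_cases h₂ : β' j <;> simp_all
  obtain ⟨i, hi⟩ := (eventually_pow_mul_eval_lt_pow (P.comp (Polynomial.C y.length * Polynomial.X
    + Polynomial.C (x.length + y.length + (y.length + z.length)))) one_lt_two).exists
  have h := key i
  simp only [one_pow, one_mul, Polynomial.eval_comp, Polynomial.eval_add, Polynomial.eval_mul,
    Polynomial.eval_C, Polynomial.eval_X] at hi
  rw [show y.length * i + (x.length + y.length + (y.length + z.length)) =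
    x.length + y.length + i * y.length + (y.length + z.length) by ring] at hi
  have : 2 ^ i ≤ 2 ^ (i + 1) := Nat.pow_le_pow_right (by omega) (by omega)
  omega

theorem IsIdempotentWord.reach_replicate {y : List α} (hy : A.IsIdempotentWord y) (i : ℕ)
    (p q : Q) : A.Reach p (List.replicate (i + 1) y).flatten q ↔ A.Reach p y q := by
  induction i generalizing p with
  | zero => simp
  | succ i ih =>
    rw [List.replicate_succ, List.flatten_cons, reach_append]
    simp only [ih]
    rw [← reach_append, hy]

theorem hasRun_replicate {p q : Q} {y : List α} {i c : ℕ} :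
    A.HasRun p (List.replicate i y).flatten q c ↔ ∃ (r : ℕ → Q) (d : ℕ → ℕ), r 0 = p ∧ r i = q ∧
      (∀ j < i, A.HasRun (r j) y (r (j + 1)) (d j)) ∧ c = ∑ j ∈ Finset.range i, d j := by
  rw [hasRun_flatten]
  simp

theorem HasRun.replicate_loop {p : Q} {y : List α} {c : ℕ} (h : A.HasRun p y p c) (i : ℕ) :
    A.HasRun p (List.replicate i y).flatten p (i * c) :=
  hasRun_replicate.2 ⟨fun _ => p, fun _ => c, rfl, rfl, fun _ _ => h, by simp⟩

/-- A long run over a power of an idempotent word contains a loop that dominates the weight of the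
run and that can be repeated once more. -/
theorem IsIdempotentWord.exists_loop [Finite Q] (hA : A.IsPolynomiallyAmbiguous) {y : List α}
    (hy : A.IsIdempotentWord y) {W : ℕ} (hW : ∀ p q c, A.HasRun p y q c → c ≤ W) {p q : Q}
    (hp : A.IsAccessible p) (hq : A.IsCoaccessible q) {i c : ℕ} (hi : Nat.card Q < i)
    (h : A.HasRun p (List.replicate i y).flatten q c) :
    ∃ s, A.Reach p y s ∧ A.Reach s y s ∧ A.Reach s y q ∧
      c ≤ Nat.card Q * W + i * A.loopWeight y s ∧
      A.HasRun p (List.replicate (i + 1) y).flatten q (c + A.loopWeight y s) := by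
  classical
  cases nonempty_fintype Q
  obtain ⟨r, d, rfl, rfl, hr, rfl⟩ := hasRun_replicate.1 h
  have hsub : ∀ j l, j + l ≤ i → A.HasRun (r j) (List.replicate l y).flatten (r (j + l))
      (∑ k ∈ Finset.range l, d (j + k)) := fun j l hl =>
    hasRun_replicate.2 ⟨fun k => r (j + k), fun k => d (j + k), rfl, rfl,
      fun k hk => hr (j + k) (by omega), rfl⟩
  have hreach : ∀ j k, j < k → k ≤ i → A.Reach (r j) y (r k) := by
    intro j k hjk hk
    have := (hsub j (k - j - 1 + 1) (by omega)).reach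
    rwa [hy.reach_replicate, show j + (k - j - 1 + 1) = k by omega] at this
  have hacc : ∀ j ≤ i, A.IsAccessible (r j) := fun j hj => by
    have := (hsub 0 j (by omega)).reach
    rw [zero_add] at this
    exact hp.of_reach this
  have hcoacc : ∀ j ≤ i, A.IsCoaccessible (r j) := fun j hj => by
    have := (hsub j (i - j) (by omega)).reach
    rw [show j + (i - j) = i by omega] at this
    exact hq.of_reach this
  set J := {j ∈ Finset.range i | r j = r (j + 1)}
  set J' := {j ∈ Finset.range i | ¬ r j = r (j + 1)}
  -- A state that is left never recurs: a return would be a forbidden cycle. Hence the steps in `J'`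
  -- start at distinct states.
  have hne : ∀ j k, j < k → k < i → r j ≠ r (j + 1) → r j ≠ r k := by
    intro j k hjk hk hj hjk'
    rcases (Nat.succ_le_of_lt hjk).eq_or_lt with h | h
    · exact hj (hjk'.trans (congrArg r h.symm))
    · refine hj (hy.antisymm hA (hacc j (by omega)) (hcoacc j (by omega))
        (hreach j (j + 1) (by omega) (by omega)) ?_)
      rw [hjk']
      exact hreach (j + 1) k h (by omega)
  have hJ' : J'.card ≤ Nat.card Q := by
    rw [Nat.card_eq_fintype_card, ← Finset.card_univ]
    refine Finset.card_le_card_of_injOn r (fun _ _ => Finset.mem_univ _) ?_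
    intro j hj k hk hjk
    simp only [J', Finset.coe_filter, Finset.mem_range, Set.mem_ofPred_eq] at hj hk
    rcases lt_trichotomy j k with h | h | h
    · exact absurd hjk (hne j k h hk.1 hj.2)
    · exact h
    · exact absurd hjk.symm (hne k j h hj.1 hk.2)
  have hJJ' : J.card + J'.card = i := by
    have := Finset.card_filter_add_card_filter_not (s := Finset.range i)
      (fun j => r j = r (j + 1))
    simpa using this
  have hJ : J.Nonempty := Finset.card_pos.1 (by omega)
  -- The heaviest loop state met by the run bounds every other loop step, and one more loop can be
  -- inserted there.
  obtain ⟨j, hj, hmax⟩ := J.exists_max_image (fun j => A.loopWeight y (r j)) hJ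
  obtain ⟨hji, hloop⟩ : j < i ∧ r j = r (j + 1) := by simpa [J] using hj
  have hself : A.Reach (r j) y (r j) := by
    conv_rhs => rw [hloop]
    exact (hr j hji).reach
  refine ⟨r j, ?_, hself, hreach j i hji le_rfl, ?_, ?_⟩
  · rw [hloop]
    exact hreach 0 (j + 1) (by omega) (by omega)
  · have h₁ : ∑ k ∈ J, d k ≤ J.card * A.loopWeight y (r j) := by
      rw [← smul_eq_mul]
      refine Finset.sum_le_card_nsmul _ _ _ fun k hk => ?_
      refine le_trans ?_ (hmax k hk)
      simp only [J, Finset.mem_filter, Finset.mem_range] at hk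
      have := hr k hk.1
      rw [← hk.2] at this
      exact this.le_loopWeight
    have h₂ : ∑ k ∈ J', d k ≤ J'.card * W := by
      rw [← smul_eq_mul]
      refine Finset.sum_le_card_nsmul _ _ _ fun k hk => ?_
      simp only [J', Finset.mem_filter, Finset.mem_range] at hk
      exact hW _ _ _ (hr k hk.1)
    rw [← Finset.sum_filter_add_sum_filter_not _ (fun j => r j = r (j + 1))]
    have h₃ : J.card * A.loopWeight y (r j) ≤ i * A.loopWeight y (r j) :=
      Nat.mul_le_mul_right _ (by omega)
    have h₄ : J'.card * W ≤ Nat.card Q * W := Nat.mul_le_mul_right _ hJ'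
    change ∑ k ∈ J, d k + ∑ k ∈ J', d k ≤ _
    omega
  · obtain ⟨l, rfl⟩ := Nat.exists_eq_add_of_le hji.le
    have h₁ := hsub 0 j (by omega)
    have h₂ := hsub j l (by omega)
    simp only [zero_add] at h₁
    have := h₁.append (hself.hasRun_loopWeight.append h₂)
    rw [show j + l + 1 = j + (1 + l) by ring, List.replicate_add, List.replicate_add,
      List.flatten_append, List.flatten_append, Finset.sum_range_add]
    convert this using 1
    · simp
    · ring

end WeightedAutomaton

/-! ### Eventual linearity. -/

/-- A sequence that is dominated at each index by one of finitely many linear functions, along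
which it also grows, and that dominates all of them, is eventually linear with maximal slope. -/
theorem eventually_eq_sup_add {ι : Type*} (g : ℕ → ℕ) (X : Finset ι) (L : ι → ℕ) (C i₀ : ℕ)
    (hA : ∀ i ≥ i₀, ∃ x ∈ X, g i ≤ C + i * L x ∧ g i + L x ≤ g (i + 1))
    (hB : ∀ x ∈ X, ∃ C', ∀ i ≥ i₀, i * L x ≤ g i + C') :
    X.Nonempty ∧ ∀ᶠ i in atTop, g (i + 1) = X.sup L + g i := by
  obtain ⟨x₀, hx₀, -⟩ := hA i₀ le_rfl
  refine ⟨⟨x₀, hx₀⟩, ?_⟩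
  obtain ⟨x, hx, hsup⟩ := X.exists_mem_eq_sup ⟨x₀, hx₀⟩ L
  obtain ⟨C', hC'⟩ := hB x hx
  set K := X.sup L
  -- A slope below `K` would give `i * K ≤ C + C' + i * (K - 1)`, that is, `i ≤ C + C'`.
  have key : ∀ i ≥ i₀ + C + C' + 1, g i ≤ C + i * K ∧ g i + K ≤ g (i + 1) := by
    intro i hi
    obtain ⟨x', hx', h₁, h₂⟩ := hA i (by omega)
    have h₃ := hC' i (by omega)
    rw [← hsup] at h₃
    have hle : L x' ≤ K := Finset.le_sup hx'
    rcases hle.eq_or_lt with h | h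
    · rw [h] at h₁ h₂
      exact ⟨h₁, h₂⟩
    · have : i * (L x' + 1) ≤ i * K := Nat.mul_le_mul_left _ h
      rw [mul_add, mul_one] at this
      omega
  set i₁ := i₀ + C + C' + 1
  -- The slack below the line `C + i * K` is a nonincreasing natural number, hence eventually
  -- constant; `key` makes the subtraction genuine.
  set h : ℕ → ℕ := fun j => C + (i₁ + j) * K - g (i₁ + j)
  have hstep : ∀ j, (i₁ + (j + 1)) * K = (i₁ + j) * K + K := fun j => by ring
  have hanti : Antitone h := antitone_nat_of_succ_le fun j => by
    have h₁ := key (i₁ + j) (by omega)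
    have h₂ := hstep j
    have h₃ : g (i₁ + (j + 1)) = g (i₁ + j + 1) := rfl
    simp only [h]
    omega
  obtain ⟨_, ⟨j₁, rfl⟩, hmin⟩ := wellFounded_lt.has_min (Set.range h) ⟨h 0, 0, rfl⟩
  filter_upwards [eventually_ge_atTop (i₁ + j₁)] with i hi
  obtain ⟨j, rfl⟩ := Nat.exists_eq_add_of_le (show i₁ ≤ i by omega)
  have h₁ := key (i₁ + j) (by omega)
  have h₂ := key (i₁ + (j + 1)) (by omega)
  have h₃ := hstep j
  have h₄ : h j = h j₁ :=
    le_antisymm (hanti (by omega)) (not_lt.1 (hmin _ ⟨j, rfl⟩))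
  have h₅ : h (j + 1) = h j₁ :=
    le_antisymm (hanti (by omega)) (not_lt.1 (hmin _ ⟨j + 1, rfl⟩))
  have h₆ : g (i₁ + (j + 1)) = g (i₁ + j + 1) := rfl
  simp only [h] at h₄ h₅
  omega

/-! ### Skeletons, anchors and pumping rates. -/

namespace WeightedAutomaton

variable {Q α : Type*} {A : WeightedAutomaton Q α MaxPlus} {n : ℕ}

/-- The states `s k` and `t k` are the ends of the gaps in an accepting run with initial state `a`
that is given only on the factors `u k`, with total weight `e`. -/
def IsSkeleton (A : WeightedAutomaton Q α MaxPlus) (u : Fin (n + 1) → List α) (a : Q)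
    (s : ℕ → Q) (t : Fin n → Q) (e : ℕ) : Prop :=
  ∃ (c₀ c₁ c₂ : ℕ) (d : Fin n → ℕ), A.I a = MaxPlus.ofNat c₀ ∧ A.HasRun a (u 0) (s 0) c₁ ∧
    (∀ k : Fin n, A.HasRun (t k) (u k.succ) (s (k + 1)) (d k)) ∧ A.F (s n) = MaxPlus.ofNat c₂ ∧
    e = c₀ + c₁ + ∑ k, d k + c₂

/-- Since `B` is arbitrary, one skeleton can be completed over different pumpings of the same word,
which makes their values comparable. -/
theorem hasAcceptingWeight_iff {u : Fin (n + 1) → List α} {B : Fin n → List α} {c : ℕ} :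
    A.HasAcceptingWeight (u 0 ++ (List.ofFn fun k => B k ++ u k.succ).flatten) c ↔
      ∃ (a : Q) (s : ℕ → Q) (t : Fin n → Q) (e : ℕ) (d : Fin n → ℕ), A.IsSkeleton u a s t e ∧
        (∀ k : Fin n, A.HasRun (s k) (B k) (t k) (d k)) ∧ c = e + ∑ k, d k := by
  constructor
  · rintro ⟨a, b, c₀, c₁, c₂, ha, h, hb, rfl⟩
    obtain ⟨p, d₁, d₂, h₁, h₂, rfl⟩ := hasRun_append.1 h
    obtain ⟨s, d, rfl, rfl, hr, rfl⟩ := hasRun_flatten.1 h₂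
    simp only [List.length_ofFn, List.getElem_ofFn] at hr hb ⊢
    have hr' : ∀ k : Fin n, ∃ t x y, A.HasRun (s k) (B k) t x ∧
        A.HasRun t (u k.succ) (s (k + 1)) y ∧ d k = x + y :=
      fun k => hasRun_append.1 (hr k k.2)
    choose t x y hx hy hd using hr'
    refine ⟨a, s, t, _, x, ⟨c₀, d₁, c₂, y, ha, h₁, hy, hb, rfl⟩, hx, ?_⟩
    rw [Finset.sum_range, Finset.sum_congr rfl fun k _ => hd k, Finset.sum_add_distrib]
    omega
  · rintro ⟨a, s, t, e, x, ⟨c₀, d₁, c₂, y, ha, h₁, hy, hb, rfl⟩, hx, rfl⟩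
    refine ⟨a, s n, c₀, d₁ + ∑ k, (x k + y k), c₂, ha, h₁.append (hasRun_flatten.2
      ⟨s, fun j => if h : j < n then x ⟨j, h⟩ + y ⟨j, h⟩ else 0, rfl, by simp, ?_, ?_⟩), hb, ?_⟩
    · intro j hj
      have hj' : j < n := by simpa using hj
      simpa [hj'] using (hx ⟨j, hj'⟩).append (hy ⟨j, hj'⟩)
    · rw [List.length_ofFn, Finset.sum_range]
      simp
    · rw [Finset.sum_add_distrib]
      omega

/-- Accessibility propagates from the left end and coaccessibility from the right. `exists_loop`
needs both. -/
theorem IsSkeleton.useful {u : Fin (n + 1) → List α} {B : Fin n → List α} {a : Q} {s : ℕ → Q}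
    {t : Fin n → Q} {e : ℕ} (h : A.IsSkeleton u a s t e)
    (hB : ∀ k : Fin n, A.Reach (s k) (B k) (t k)) (k : Fin n) :
    A.IsAccessible (s k) ∧ A.IsCoaccessible (t k) := by
  obtain ⟨c₀, c₁, c₂, d, ha, h₁, hd, hb, -⟩ := h
  have hacc : ∀ j ≤ n, A.IsAccessible (s j) := by
    intro j
    induction j with
    | zero => exact fun _ => ⟨a, u 0, by rw [ha]; exact MaxPlus.ofNat_ne_zero _, h₁.reach⟩
    | succ j ih =>
      intro hj
      exact ((ih (by omega)).of_reach (hB ⟨j, hj⟩)).of_reach (hd ⟨j, hj⟩).reach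
  have hcoacc : ∀ j ≤ n, A.IsCoaccessible (s (n - j)) := by
    intro j
    induction j with
    | zero => exact fun _ => ⟨s n, [], by rw [hb]; exact MaxPlus.ofNat_ne_zero _, 0, rfl, rfl⟩
    | succ j ih =>
      intro hj
      have h₁ := (hd ⟨n - (j + 1), by omega⟩).reach
      simp only [show n - (j + 1) + 1 = n - j by omega] at h₁
      exact ((ih (by omega)).of_reach h₁).of_reach (hB ⟨n - (j + 1), by omega⟩)
  refine ⟨hacc k k.2.le, ?_⟩
  have := hcoacc (n - (k + 1)) (by omega)
  rw [show n - (n - (k.val + 1)) = k + 1 by omega] at this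
  exact this.of_reach (hd k).reach

/-- The states `σ k` carry loops over the pumping factors and lie on a common accepting run. -/
def IsAnchor (A : WeightedAutomaton Q α MaxPlus) (P : PumpingRep α n) (σ : Fin n → Q) : Prop :=
  ∃ a s t e, A.IsSkeleton P.u a s t e ∧ ∀ k : Fin n, A.Reach (s k) (P.v k) (σ k) ∧
    A.Reach (σ k) (P.v k) (σ k) ∧ A.Reach (σ k) (P.v k) (t k)

open Classical in
/-- The pumping rate of a set of factors is the largest total weight of loops at the states of an
anchor. -/
theorem eventually_pump [Fintype Q] (hA : A.IsPolynomiallyAmbiguous)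
    {f : List α → ℕ} (hf : ∀ w, IsGreatest {c | A.HasAcceptingWeight w c} (f w))
    (P : PumpingRep α n) (hP : ∀ k, A.IsIdempotentWord (P.v k)) (S : Finset (Fin n)) :
    ({σ | A.IsAnchor P σ} : Finset (Fin n → Q)).Nonempty ∧ ∀ᶠ i in atTop, f (P.pump S (i + 1)) =
      ({σ | A.IsAnchor P σ} : Finset (Fin n → Q)).sup
        (fun σ => ∑ k ∈ S, A.loopWeight (P.v k) (σ k)) + f (P.pump S i) := by
  choose W hW using fun k => A.exists_hasRun_le (P.v k)
  have hself : P.word = P.u 0 ++ (List.ofFn fun k => P.v k ++ P.u k.succ).flatten := rfl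
  -- `f P.word` bounds the skeleton weight, `Nat.card Q * W k` the non-loop steps of a pumped block,
  -- `W k` an unpumped block. The threshold exceeds `Nat.card Q` for `exists_loop` and leaves two
  -- copies for entering and leaving the loop.
  refine eventually_eq_sup_add (fun i => f (P.pump S i)) _ _
    (f P.word + ∑ k, (Nat.card Q * W k + W k)) (Nat.card Q + 2) ?_ ?_
  · intro i hi
    obtain ⟨a, s, t, e, d, hs, hd, hc⟩ := hasAcceptingWeight_iff.1 (hf (P.pump S i)).1
    have hreach : ∀ k : Fin n, A.Reach (s k) (P.v k) (t k) := by
      intro k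
      have := (hd k).reach
      split_ifs at this
      · obtain ⟨i, rfl⟩ := Nat.exists_eq_add_of_le' (show 1 ≤ i by omega)
        rwa [(hP k).reach_replicate] at this
      · exact this
    have hloop : ∀ k : Fin n, ∃ σ, A.Reach (s k) (P.v k) σ ∧ A.Reach σ (P.v k) σ ∧
        A.Reach σ (P.v k) (t k) ∧ (d k ≤ Nat.card Q * W k + W k +
          if k ∈ S then i * A.loopWeight (P.v k) σ else 0) ∧
        A.HasRun (s k) (if k ∈ S then (List.replicate (i + 1) (P.v k)).flatten else P.v k) (t k)
          (d k + if k ∈ S then A.loopWeight (P.v k) σ else 0) := by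
      intro k
      have hu := hs.useful hreach k
      have hdk := hd k
      by_cases hk : k ∈ S
      · simp only [hk, if_true] at hdk ⊢
        obtain ⟨σ, h₁, h₂, h₃, h₄, h₅⟩ :=
          (hP k).exists_loop hA (hW k) hu.1 hu.2 (by omega) hdk
        exact ⟨σ, h₁, h₂, h₃, by omega, h₅⟩
      · simp only [hk, if_false] at hdk ⊢
        -- An unpumped block also needs a loop state, as anchors are independent of `S`; idempotence
        -- allows passing to a long power to find one.
        obtain ⟨c, hc⟩ := ((hP k).reach_replicate (Nat.card Q) _ _).2 (hreach k)
        obtain ⟨σ, h₁, h₂, h₃, -⟩ :=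
          (hP k).exists_loop hA (hW k) hu.1 hu.2 (Nat.lt_succ_self _) hc
        have := hW k _ _ _ hdk
        exact ⟨σ, h₁, h₂, h₃, by omega, hdk⟩
    choose σ h₁ h₂ h₃ h₄ h₅ using hloop
    have he : e ≤ f P.word := by
      choose d' hd' using hreach
      exact (Nat.le_add_right _ _).trans ((hf P.word).2 (hself ▸ hasAcceptingWeight_iff.2
        ⟨a, s, t, e, d', hs, hd', rfl⟩))
    refine ⟨σ, by simpa using ⟨a, s, t, e, hs, fun k => ⟨h₁ k, h₂ k, h₃ k⟩⟩, ?_, ?_⟩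
    · have := Finset.sum_le_sum fun k (_ : k ∈ Finset.univ) => h₄ k
      rw [Finset.sum_add_distrib, Finset.sum_ite_mem, Finset.univ_inter, ← Finset.mul_sum] at this
      omega
    · have := (hf (P.pump S (i + 1))).2 (hasAcceptingWeight_iff.2 ⟨a, s, t, e, _, hs, h₅, rfl⟩)
      rw [Finset.sum_add_distrib, Finset.sum_ite_mem, Finset.univ_inter] at this
      omega
  · intro σ hσ
    obtain ⟨a, s, t, e, hs, h⟩ := (Finset.mem_filter.1 hσ).2
    -- Two of the `i` copies lead to `σ k` and away from it, so two loops are lost.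
    refine ⟨2 * ∑ k ∈ S, A.loopWeight (P.v k) (σ k), fun i hi => ?_⟩
    obtain ⟨i, rfl⟩ := Nat.exists_eq_add_of_le' (show 2 ≤ i by omega)
    have hrun : ∀ k : Fin n, ∃ d, A.HasRun (s k)
        (if k ∈ S then (List.replicate (i + 2) (P.v k)).flatten else P.v k) (t k) d ∧
        (if k ∈ S then i * A.loopWeight (P.v k) (σ k) else 0) ≤ d := by
      intro k
      obtain ⟨⟨d₁, h₁⟩, h₂, ⟨d₃, h₃⟩⟩ := h k
      by_cases hk : k ∈ S
      · simp only [hk, if_true]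
        refine ⟨d₁ + (i * A.loopWeight (P.v k) (σ k) + d₃), ?_, by omega⟩
        have := h₁.append ((h₂.hasRun_loopWeight.replicate_loop i).append h₃)
        rw [show i + 2 = 1 + (i + 1) by ring, List.replicate_add, List.replicate_add]
        simpa using this
      · simp only [hk, if_false]
        obtain ⟨d, hd⟩ := (hP k _ _).1 (h₁.append h₃).reach
        exact ⟨d, hd, Nat.zero_le _⟩
    choose d hd hle using hrun
    have h₁ := (hf (P.pump S (i + 2))).2 (hasAcceptingWeight_iff.2 ⟨a, s, t, e, _, hs, hd, rfl⟩)
    have h₂ := Finset.sum_le_sum fun k (_ : k ∈ Finset.univ) => hle k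
    rw [Finset.sum_ite_mem, Finset.univ_inter, ← Finset.mul_sum] at h₂
    simp only [add_mul]
    omega

/-- The number of anchors is bounded by a polynomial in the number of pumping factors. -/
theorem exists_card_anchor_le [Finite Q] (hA : A.IsPolynomiallyAmbiguous) :
    ∃ p : Polynomial ℕ, ∀ (n : ℕ) (P : PumpingRep α n) (X : Finset (Fin n → Q)),
      (∀ σ ∈ X, A.IsAnchor P σ) → ∀ l, n ≤ l → X.card ≤ p.eval l := by
  obtain ⟨p, hp⟩ := hA
  obtain ⟨C, hC⟩ := A.exists_short_word
  choose rep hrep hrep' using hC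
  have hmono : Monotone fun m => p.eval m := by
    intro m m' h
    simp only [Polynomial.eval_eq_sum_range]
    gcongr
  refine ⟨p.comp ((Polynomial.X + 1) * Polynomial.C C), fun n P X hX l hl => ?_⟩
  rcases X.eq_empty_or_nonempty with rfl | ⟨σ₀, hσ₀⟩
  · simp
  have : Nonempty Q := ⟨(hX σ₀ hσ₀).choose⟩
  choose! a s t e hs hσ using hX
  have hs' : ∀ σ ∈ X, A.I (a σ) ≠ 0 ∧ A.F (s σ n) ≠ 0 ∧ A.Reach (a σ) (P.u 0) (s σ 0) ∧
      ∀ k : Fin n, A.Reach (t σ k) (P.u k.succ) (s σ (k + 1)) := by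
    intro σ hσX
    obtain ⟨c₀, c₁, c₂, d, ha, h₁, hd, hb, -⟩ := hs σ hσX
    exact ⟨ha ▸ MaxPlus.ofNat_ne_zero _, hb ▸ MaxPlus.ofNat_ne_zero _, h₁.reach,
      fun k => (hd k).reach⟩
  -- The gap between consecutive anchor states reads `yₖ uₖ yₖ₊₁`, without the missing `y` at either
  -- end; a word of length at most `C` with the same relation replaces it.
  set ws : List (List α) := List.ofFn fun k : Fin (n + 1) =>
    rep ((Fin.cons [] P.v : Fin (n + 1) → List α) k ++ P.u k ++
      (Fin.snoc P.v [] : Fin (n + 1) → List α) k)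
  have hlen : ws.length = n + 1 := by simp [ws]
  -- The checkpoints are the initial state, the anchor states and the final state, so they determine
  -- `σ`.
  let ck : (Fin n → Q) → ℕ → Q := fun σ j =>
    Nat.casesOn j (a σ) fun j => if h : j < n then σ ⟨j, h⟩ else s σ n
  have hck : ∀ σ (k : Fin n), ck σ (k + 1) = σ k := fun σ k => by simp [ck]
  have hlast : ∀ σ, ck σ (n + 1) = s σ n := fun σ => by simp [ck]
  have hcard := card_le_ncard_acceptingRuns (A := A) ws X ck (fun σ hσX => (hs' σ hσX).1)
    (fun σ hσX => by rw [hlen, hlast]; exact (hs' σ hσX).2.1) ?_ ?_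
  · refine hcard.trans ((hp _).trans ?_)
    simp only [Polynomial.eval_comp, Polynomial.eval_mul, Polynomial.eval_add, Polynomial.eval_X,
      Polynomial.eval_one, Polynomial.eval_C]
    refine hmono ?_
    have : ws.flatten.length ≤ ws.length * C := by
      rw [List.length_flatten]
      refine (List.sum_le_card_nsmul _ C ?_).trans (by simp)
      intro x hx
      simp only [ws, List.mem_map, List.mem_ofFn] at hx
      obtain ⟨_, ⟨k, rfl⟩, rfl⟩ := hx
      exact hrep _
    rw [hlen] at this
    exact this.trans (Nat.mul_le_mul_right _ (by omega))
  · intro σ hσX j hj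
    rw [hlen] at hj
    simp only [ws, List.getElem_ofFn]
    rw [hrep']
    obtain ⟨-, -, h₀, h₁⟩ := hs' σ hσX
    have hin : ∀ k : Fin (n + 1),
        A.Reach (ck σ k) ((Fin.cons [] P.v : Fin (n + 1) → List α) k ++ P.u k) (s σ k) := by
      intro k
      refine Fin.cases ?_ (fun k => ?_) k
      · exact h₀
      · rw [Fin.cons_succ, Fin.val_succ, hck]
        exact (hσ σ hσX k).2.2.append (h₁ k)
    have hout : ∀ k : Fin (n + 1),
        A.Reach (s σ k) ((Fin.snoc P.v [] : Fin (n + 1) → List α) k) (ck σ (k + 1)) := by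
      intro k
      refine Fin.lastCases ?_ (fun k => ?_) k
      · rw [Fin.snoc_last, Fin.val_last, hlast]
        exact ⟨0, rfl, rfl⟩
      · rw [Fin.snoc_castSucc, Fin.val_castSucc, hck]
        exact (hσ σ hσX k).1
    exact (hin ⟨j, hj⟩).append (hout ⟨j, hj⟩)
  · intro σ _ σ' _ h
    funext k
    rw [← hck σ k, ← hck σ' k]
    exact h (k + 1) (by rw [hlen]; omega)

end WeightedAutomaton

/-! ### Counting selections and conclusion. -/

/-- If every selection from `m` sets of size at most `s` lies in some member of a family, none of
which contains one of the sets, then the family is large. -/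
theorem succ_pow_le_pow_mul_card {ι κ : Type*} [DecidableEq ι] {m s : ℕ}
    (S : Fin m → Finset ι) (hne : ∀ j, (S j).Nonempty) (hs : ∀ j, (S j).card ≤ s)
    (X : Finset κ) (O : κ → Finset ι) (hO : ∀ x ∈ X, ∀ j, ¬ S j ⊆ O x)
    (hsel : ∀ T ∈ Fintype.piFinset S, ∃ x ∈ X, ∀ j, T j ∈ O x) :
    (s + 1) ^ m ≤ s ^ m * X.card := by
  -- Each member of the family misses a point of every `S j`, so it contains at most `∏ (|S j| - 1)`
  -- selections.
  have h₁ : ∏ j, (S j).card ≤ X.card * ∏ j, ((S j).card - 1) := by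
    rw [← Fintype.card_piFinset]
    have hsub : Fintype.piFinset S ⊆ X.biUnion fun x => Fintype.piFinset fun j => S j ∩ O x := by
      intro T hT
      obtain ⟨x, hx, h⟩ := hsel T hT
      simp only [Finset.mem_biUnion, Fintype.mem_piFinset, Finset.mem_inter] at hT ⊢
      exact ⟨x, hx, fun j => ⟨hT j, h j⟩⟩
    refine (Finset.card_le_card hsub).trans (Finset.card_biUnion_le_card_mul _ _ _ fun x hx => ?_)
    rw [Fintype.card_piFinset]
    refine Finset.prod_le_prod' fun j _ => Nat.le_sub_one_of_lt (Finset.card_lt_card ?_)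
    exact ⟨Finset.inter_subset_left, fun h => hO x hx j (h.trans Finset.inter_subset_right)⟩
  have hpos : 0 < ∏ j, (S j).card := Finset.prod_pos fun j _ => Finset.card_pos.2 (hne j)
  -- A singleton `S j` would make the right side of `h₁` vanish, though selections exist.
  have hpos' : 0 < ∏ j, ((S j).card - 1) := by
    by_contra h
    rw [Nat.eq_zero_of_not_pos h] at h₁
    omega
  -- Factorwise, `(s + 1) * b ≤ s * (b + 1)` holds when `b + 1 = |S j| ≤ s`.
  have h₂ : (s + 1) ^ m * ∏ j, ((S j).card - 1) ≤ s ^ m * ∏ j, (S j).card := by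
    rw [← Fin.prod_const, ← Fin.prod_const, ← Finset.prod_mul_distrib, ← Finset.prod_mul_distrib]
    refine Finset.prod_le_prod' fun j _ => ?_
    obtain ⟨b, hb⟩ := Nat.exists_eq_add_of_le' (Finset.card_pos.2 (hne j))
    have := hs j
    rw [hb] at this ⊢
    rw [Nat.add_sub_cancel]
    nlinarith
  refine Nat.le_of_mul_le_mul_right ?_ hpos'
  calc _ ≤ s ^ m * ∏ j, (S j).card := h₂
    _ ≤ s ^ m * (X.card * ∏ j, ((S j).card - 1)) := Nat.mul_le_mul_left _ h₁
    _ = _ := by ring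

namespace PumpingRep

variable {α : Type*} {n : ℕ} {f : List α → ℕ} {P : PumpingRep α n}

/-- If the rates are maxima of sums of local weights over `X`, then `S` is decomposable iff some
member of `X` is optimal at all indices in `S`. -/
theorem isDecomposable_iff (hP : P.IsLinear f) {κ : Type*} {X : Finset κ} (hX : X.Nonempty)
    {L : Fin n → κ → ℕ} (hL : ∀ S, delta hP S = X.sup fun x => ∑ k ∈ S, L k x)
    (S : Finset (Fin n)) :
    IsDecomposable hP S ↔ ∃ x ∈ X, ∀ k ∈ S, L k x = delta hP {k} := by
  have hle : ∀ x ∈ X, ∀ k, L k x ≤ delta hP {k} := by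
    intro x hx k
    rw [hL]
    simpa using Finset.le_sup (f := L k) hx
  obtain ⟨x, hx, hsup⟩ := X.exists_mem_eq_sup hX fun x => ∑ k ∈ S, L k x
  unfold IsDecomposable
  constructor
  · intro h
    rw [hL, hsup] at h
    -- Each term is at most its singleton rate, so equal sums force equality at every index.
    exact ⟨x, hx, (Finset.sum_eq_sum_iff_of_le fun k _ => hle x hx k).1 h⟩
  · rintro ⟨y, hy, h⟩
    apply le_antisymm
    · rw [hL, hsup]
      exact Finset.sum_le_sum fun k _ => hle x hx k
    · rw [hL S, ← Finset.sum_congr rfl h]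
      exact Finset.le_sup (f := fun x => ∑ k ∈ S, L k x) hy

end PumpingRep

theorem mainTheorem5 {α : Type*} [Finite α] (f : List α → ℕ)
    (hf : IsPolyAmbiguouslyRecognisableMaxPlus f) :
    ∃ (N : ℕ) (φ : ℕ → ℕ), ∀ (n : ℕ), 0 < n → ∀ P : PumpingRep α n,
      (∀ k, N ≤ (P.v k).length) →
      ∃ P' : PumpingRep α n, P.IsRefinement P' ∧ ∃ hlin : P'.IsLinear f,
        ∀ (m : ℕ) (S : Fin m → Finset (Fin n)), IsPartitionSeq S →
          φ (Finset.univ.sup fun j => (S j).card) ≤ m →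
          (∃ j, PumpingRep.IsDecomposable hlin (S j)) ∨
          ∃ T : Finset (Fin n), IsSelectionSet S T ∧ ¬ PumpingRep.IsDecomposable hlin T := by
  classical
  obtain ⟨Q, _, _, A, hA, hout⟩ := hf
  have hf' : ∀ w, IsGreatest {c | A.HasAcceptingWeight w c} (f w) := fun w =>
    WeightedAutomaton.isGreatest_of_output_eq (hout w)
  obtain ⟨N, hN⟩ := A.exists_idempotent_factor
  obtain ⟨p, hp⟩ := WeightedAutomaton.exists_card_anchor_le hA
  -- `φ s` is a threshold beyond which `s ^ m * p (m * s) < (s + 1) ^ m`.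
  choose φ hφ using fun s : ℕ => eventually_atTop.1 (eventually_pow_mul_eval_lt_pow
    (p.comp (Polynomial.X * Polynomial.C s)) (Nat.lt_succ_self s))
  refine ⟨N, φ, fun n hn P hPN => ?_⟩
  choose x y z hxyz hy hidem using fun k => hN (P.v k) (hPN k)
  let P' : PumpingRep α n := ⟨fun k => (Fin.cons [] z : Fin (n + 1) → List α) k ++ P.u k ++
    (Fin.snoc x [] : Fin (n + 1) → List α) k, y, hy⟩
  have hpump := WeightedAutomaton.eventually_pump hA hf' P' hidem
  have hlin : P'.IsLinear f := fun S => ⟨_, (hpump S).2⟩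
  refine ⟨P', ⟨x, z, hxyz, fun _ => rfl⟩, hlin, fun m S hS hm => ?_⟩
  set X : Finset (Fin n → Q) := {σ | A.IsAnchor P' σ}
  have hdelta : ∀ S, PumpingRep.delta hlin S =
      X.sup fun σ => ∑ k ∈ S, A.loopWeight (P'.v k) (σ k) :=
    fun S => PumpingRep.delta_eq hlin S (hpump S).2
  have hX : X.Nonempty := (hpump ∅).1
  have hdec := PumpingRep.isDecomposable_iff hlin hX
    (L := fun k σ => A.loopWeight (P'.v k) (σ k)) hdelta
  by_contra! hcon
  obtain ⟨h₁, h₂⟩ := hcon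
  set s := Finset.univ.sup fun j => (S j).card
  have hs : ∀ j, (S j).card ≤ s := fun j =>
    Finset.le_sup (f := fun j => (S j).card) (Finset.mem_univ j)
  have hns : n ≤ m * s := by
    have : (Finset.univ : Finset (Fin n)) ⊆ Finset.univ.biUnion S := fun k _ => by
      obtain ⟨j, hj⟩ := hS.2.2 k
      exact Finset.mem_biUnion.2 ⟨j, Finset.mem_univ _, hj⟩
    simpa using (Finset.card_le_card this).trans
      (Finset.card_biUnion_le_card_mul _ _ _ fun j _ => hs j)
  have hlow := succ_pow_le_pow_mul_card S hS.1 hs X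
    (fun σ => {k | A.loopWeight (P'.v k) (σ k) = PumpingRep.delta hlin {k}})
    (fun σ hσ j hsub => h₁ j ((hdec _).2
      ⟨σ, hσ, fun k hk => (Finset.mem_filter.1 (hsub hk)).2⟩)) ?_
  · have hup := hp n P' X (fun σ hσ => (Finset.mem_filter.1 hσ).2) (m * s) hns
    have := hφ s m hm
    simp only [Polynomial.eval_comp, Polynomial.eval_mul, Polynomial.eval_X,
      Polynomial.eval_C] at this
    exact absurd (hlow.trans (Nat.mul_le_mul_left _ hup)) (not_le.2 this)
  · intro T hT
    rw [Fintype.mem_piFinset] at hT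
    -- The image of a choice function is a selection set because the parts are disjoint.
    obtain ⟨σ, hσ, h⟩ := (hdec _).1 (h₂ (Finset.univ.image T) fun j => by
      rw [Finset.card_eq_one]
      refine ⟨T j, Finset.eq_singleton_iff_unique_mem.2 ⟨by simp [hT j], ?_⟩⟩
      intro k hk
      obtain ⟨hk, hk'⟩ := Finset.mem_inter.1 hk
      obtain ⟨j', -, rfl⟩ := Finset.mem_image.1 hk
      by_contra hne
      have hjj' : j' ≠ j := by rintro rfl; exact hne rfl
      exact Finset.disjoint_left.1 (hS.2.1 j' j hjj') (hT j') hk')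
    exact ⟨σ, hσ, fun j => by simpa using h (T j) (by simp)⟩
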